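/- \textbf{Proposition (Exponential distribution).} Let $(\Omega,\mathcal A,\mathbb P)$ be a probability space, $\lambda>0$, $a\in\mathbb R$, and let $d\ge 1$ be an integer. For a distribution function $F$ put $F^{-1}(q)=\inf\{x\in\mathbb R: F(x)\ge q\}$, $q\in(0,1)$. Let $X_1,X_2$ be real random variables on $\Omega$ with distribution functions $F_1,F_2$, where $X_1$ has finite expectation and $X_2+a\sim\mathrm{Exp}(\lambda)$ (so that $X_2$ is supported by $[-a,\infty)$), and let $G_2$ be the distribution function of $X_2^d$. Let $U,V$ be independent random variables on $\Omega$, both uniform on $[0,1]$. Let $$M=\sup \mathbb E(Y_1Y_2^d),\qquad m=\inf \mathbb E(Y_1Y_2^d),$$ over all pairs $(Y_1,Y_2)$ of random variables on $\Omega$ with $Y_1\sim F_1$, $Y_2\sim F_2$ for which the expectation exists in $[-\infty,\infty]$. Put $R=\sqrt{U^2+4e^{-2a\lambda}}$, $$p=\frac{1+\frac{4e^{-2a\lambda}}{(U-R)^2}}{2+\frac{4e^{-2a\lambda}}{(U+R)^2}+\frac{4e^{-2a\lambda}}{(U-R)^2}},\qquad J=\mathbf 1_{\{V>p\}},\qquad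 I=\mathbf 1_{\{U>F_2(a)\}},$$ and let $$U_2=(1-I)\Big[J\Big(1+\frac{U-R}{2}\Big)+(1-J)\Big(1-\frac{U+R}{2}\Big)\Big]+I\,U\quad\text{if } d \text{ is even},\qquad U_2=U\quad\text{if } d\text{ is odd}.$$ Then $U_2$ is uniform on $[0,1]$, all expectations below exist in $[-\infty,\infty]$, and: (i) $M=\mathbb E\big(F_1^{-1}(U)\,G_2^{-1}(U)\big)$, and $M$ is attained by $(Y_1,Y_2)=(F_1^{-1}(U_1),F_2^{-1}(U_2))$ with $U_1=U$, that is, this pair has marginals $F_1,F_2$ and $\mathbb E(Y_1Y_2^d)=M$; (ii) $m=\mathbb E\big(F_1^{-1}(1-U)\,G_2^{-1}(U)\big)$, and $m$ is attained by $(Y_1,Y_2)=(F_1^{-1}(U_1),F_2^{-1}(U_2))$ with $U_1=1-U$ and the same $U_2$. -/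

import Mathlib

open MeasureTheory ProbabilityTheory

noncomputable section

/-- The generalized quantile function `F⁻¹(p) = inf {x : F x ≥ p}`, for `p ∈ (0, 1)`. -/
def quantile (F : ℝ → ℝ) (p : ℝ) : ℝ := sInf {x : ℝ | p ≤ F x}

/-- The expectation of `Z` exists in `[-∞, ∞]`: the positive and the negative part of `Z` do not
both have an infinite expectation. -/
def HasExpectation {Ω : Type*} [MeasurableSpace Ω] (P : Measure Ω) (Z : Ω → ℝ) : Prop :=
  AEMeasurable Z P ∧
    (∫⁻ ω, ENNReal.ofReal (Z ω) ∂P ≠ ⊤ ∨ ∫⁻ ω, ENNReal.ofReal (-Z ω) ∂P ≠ ⊤)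

/-- The expectation `E Z⁺ - E Z⁻` in `[-∞, ∞]`; used only where it exists. -/
def expectation {Ω : Type*} [MeasurableSpace Ω] (P : Measure Ω) (Z : Ω → ℝ) : EReal :=
  ((∫⁻ ω, ENNReal.ofReal (Z ω) ∂P : ENNReal) : EReal) -
    ((∫⁻ ω, ENNReal.ofReal (-Z ω) ∂P : ENNReal) : EReal)

/-- For integrable random variables the expectation exists and is the Bochner integral. -/
theorem expectation_eq_integral {Ω : Type*} [MeasurableSpace Ω] {P : Measure Ω} {Z : Ω → ℝ}
    (hZ : Integrable Z P) :
    HasExpectation P Z ∧ expectation P Z = ((∫ ω, Z ω ∂P : ℝ) : EReal) := by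
  have h1 : ∫⁻ ω, ENNReal.ofReal (Z ω) ∂P ≠ ⊤ := hZ.lintegral_lt_top.ne
  have h2 : ∫⁻ ω, ENNReal.ofReal (-Z ω) ∂P ≠ ⊤ := hZ.neg.lintegral_lt_top.ne
  refine ⟨⟨hZ.aemeasurable, Or.inl h1⟩, ?_⟩
  rw [integral_eq_lintegral_pos_part_sub_lintegral_neg_part hZ, EReal.coe_sub, expectation,
    EReal.coe_ennreal_toReal h1, EReal.coe_ennreal_toReal h2]

/-- The pair `(Y₁, Y₂)` has the marginal laws `ν₁` and `ν₂`, and `E (Y₁ Y₂ ^ d)` exists and is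
equal to `t`. -/
def HasMixedMoment {Ω : Type*} [MeasurableSpace Ω] (P : Measure Ω) (ν₁ ν₂ : Measure ℝ) (d : ℕ)
    (Y₁ Y₂ : Ω → ℝ) (t : EReal) : Prop :=
  HasLaw Y₁ ν₁ P ∧ HasLaw Y₂ ν₂ P ∧ HasExpectation P (fun ω => Y₁ ω * Y₂ ω ^ d) ∧
    expectation P (fun ω => Y₁ ω * Y₂ ω ^ d) = t

/-- `M`, the supremum of `E (Y₁ Y₂ ^ d)` over all pairs with marginal laws `ν₁` and `ν₂`. -/
def maxMixedMoment {Ω : Type*} [MeasurableSpace Ω] (P : Measure Ω) (ν₁ ν₂ : Measure ℝ)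
    (d : ℕ) : EReal :=
  sSup {t | ∃ Y₁ Y₂ : Ω → ℝ, HasMixedMoment P ν₁ ν₂ d Y₁ Y₂ t}

/-- `m`, the infimum of `E (Y₁ Y₂ ^ d)` over all pairs with marginal laws `ν₁` and `ν₂`. -/
def minMixedMoment {Ω : Type*} [MeasurableSpace Ω] (P : Measure Ω) (ν₁ ν₂ : Measure ℝ)
    (d : ℕ) : EReal :=
  sInf {t | ∃ Y₁ Y₂ : Ω → ℝ, HasMixedMoment P ν₁ ν₂ d Y₁ Y₂ t}

/-- The uniform distribution on `[0, 1]`. -/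
def uniform01 : Measure ℝ := volume.restrict (Set.Icc (0 : ℝ) 1)

/-- `√(u² + 4 e^{-2aλ})`. -/
def expRoot (lam a u : ℝ) : ℝ := √(u ^ 2 + 4 * Real.exp (-2 * a * lam))

/-- The mixing probability `p`, as a function of the value `u` of `U`. -/
def mixProb (lam a u : ℝ) : ℝ :=
  (1 + 4 * Real.exp (-2 * a * lam) / (u - expRoot lam a u) ^ 2) /
    (2 + 4 * Real.exp (-2 * a * lam) / (u + expRoot lam a u) ^ 2 +
      4 * Real.exp (-2 * a * lam) / (u - expRoot lam a u) ^ 2)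

open Classical in
/-- The value of
`U₂ = (1 - I) [J (1 + (U - √(U² + 4 e^{-2aλ})) / 2) + (1 - J) (1 - (U + √(U² + 4 e^{-2aλ})) / 2)] + I U`
at `U = u`, `V = v`, with `I = 1_{U > F₂(a)}` and `J = 1_{V > p}`. -/
def mixU₂ (F₂ : ℝ → ℝ) (lam a u v : ℝ) : ℝ :=
  let I : ℝ := if u > F₂ a then 1 else 0
  let J : ℝ := if v > mixProb lam a u then 1 else 0
  (1 - I) * (J * (1 + (u - expRoot lam a u) / 2) + (1 - J) * (1 - (u + expRoot lam a u) / 2)) +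
    I * u

end

/-!
Among the couplings of two laws, `P (X > x, Y > y)` is largest when `X` and `Y` are comonotone,
because one of the two events then contains the other, and smallest when they are antimonotone,
because the events are then disjoint or cover the whole space. By the layer cake formula the same
holds for `E (X * Y)`, so it suffices to realise `X₂ ^ d` as an increasing function of `U`. For odd
`d` the quantile transform does this.

For even `d`, `U` has to be the rank of `|X₂|`. When `u < 1 - e^{-2aλ}`, the levels `q > q'` of
`X₂` whose quantiles are `±` the `u`-quantile of `|X₂|` are determined by `q - q' = u` and
`(1 - q) * (1 - q') = e^{-2aλ}`; the solutions of this quadratic system are the two branches of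
`U₂`. As `u` increases from `0`, the upper branch rises with speed `1 - p` and the lower one falls
with speed `p`, so that choosing them with these probabilities makes `U₂` uniform. Above
`1 - e^{-2aλ}` only the positive level is left.
-/

open Set Filter Topology

section Rearrangement

variable {Ω Ω' : Type*} [MeasurableSpace Ω] [MeasurableSpace Ω'] {P : Measure Ω} {P' : Measure Ω'}
  {X Y : Ω → ℝ} {X' Y' : Ω' → ℝ} {s : Set Ω'}

theorem measure_lt_and_lt_le_of_monovaryOn (hX : IdentDistrib X X' P P')
    (hY : IdentDistrib Y Y' P P') (hs : ∀ᵐ ω ∂P', ω ∈ s) (h : MonovaryOn X' Y' s) (x y : ℝ) :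
    P {ω | x < X ω ∧ y < Y ω} ≤ P' {ω | x < X' ω ∧ y < Y' ω} := by
  by_cases hsub : ∀ ω ∈ s, x < X' ω → y < Y' ω
  · calc P {ω | x < X ω ∧ y < Y ω} ≤ P {ω | x < X ω} := measure_mono fun _ hω => hω.1
      _ = P' {ω | x < X' ω} := hX.measure_mem_eq measurableSet_Ioi
      _ ≤ P' {ω | x < X' ω ∧ y < Y' ω} :=
        measure_mono_ae (hs.mono fun ω hω hx => ⟨hx, hsub ω hω hx⟩)
  · push Not at hsub
    obtain ⟨ω₀, hω₀, hx₀, hy₀⟩ := hsub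
    calc P {ω | x < X ω ∧ y < Y ω} ≤ P {ω | y < Y ω} := measure_mono fun _ hω => hω.2
      _ = P' {ω | y < Y' ω} := hY.measure_mem_eq measurableSet_Ioi
      _ ≤ P' {ω | x < X' ω ∧ y < Y' ω} :=
        measure_mono_ae (hs.mono fun ω hω hy =>
          ⟨hx₀.trans_le (h hω₀ hω (hy₀.trans_lt hy)), hy⟩)

theorem measure_lt_and_lt_le_of_antivaryOn [IsFiniteMeasure P] (hX : IdentDistrib X X' P P')
    (hY : IdentDistrib Y Y' P P') (hs : ∀ᵐ ω ∂P', ω ∈ s) (h : AntivaryOn X' Y' s) (x y : ℝ) :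
    P' {ω | x < X' ω ∧ y < Y' ω} ≤ P {ω | x < X ω ∧ y < Y ω} := by
  by_cases hmeet : ∃ ω ∈ s, x < X' ω ∧ y < Y' ω
  · obtain ⟨ω₀, hω₀, hx₀, hy₀⟩ := hmeet
    have hcover : ({ω | x < X' ω} ∪ {ω | y < Y' ω} : Set Ω') =ᵐ[P'] univ := by
      refine eventuallyEq_univ.2 (hs.mono fun ω hω => or_iff_not_imp_right.2 fun hy => ?_)
      exact hx₀.trans_le (h hω hω₀ ((not_lt.1 hy).trans_lt hy₀))
    have hadd : P' univ + P' {ω | x < X' ω ∧ y < Y' ω} =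
        P ({ω | x < X ω} ∪ {ω | y < Y ω}) + P {ω | x < X ω ∧ y < Y ω} := by
      rw [← measure_congr hcover, ofPred_and, ofPred_and, measure_union_add_inter₀ _
        (nullMeasurableSet_lt aemeasurable_const hY.aemeasurable_snd), measure_union_add_inter₀ _
        (nullMeasurableSet_lt aemeasurable_const hY.aemeasurable_fst)]
      exact congrArg₂ (· + ·) (hX.measure_mem_eq measurableSet_Ioi).symm
        (hY.measure_mem_eq measurableSet_Ioi).symm
    have hmass : P univ = P' univ := hX.measure_mem_eq MeasurableSet.univ
    rw [← hmass] at hadd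
    refine (ENNReal.add_le_add_iff_left (measure_ne_top P univ)).1 (hadd.trans_le ?_)
    gcongr
    exact subset_univ _
  · have hnull : P' {ω | x < X' ω ∧ y < Y' ω} = 0 :=
      measure_eq_zero_iff_ae_notMem.2 (hs.mono fun ω hω hxy => hmeet ⟨ω, hω, hxy⟩)
    exact hnull.trans_le zero_le

theorem lintegral_ofReal_mul_ofReal_eq_lintegral_measure_lt_and_lt [SFinite P]
    (hX : AEMeasurable X P) (hY : AEMeasurable Y P) :
    ∫⁻ ω, ENNReal.ofReal (X ω) * ENNReal.ofReal (Y ω) ∂P =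
      ∫⁻ w in Ioi (0 : ℝ) ×ˢ Ioi (0 : ℝ), P {ω | w.1 < X ω ∧ w.2 < Y ω} := by
  wlog hmeas : Measurable X ∧ Measurable Y generalizing X Y
  · have hcongr (w : ℝ × ℝ) : P {ω | w.1 < X ω ∧ w.2 < Y ω} =
        P {ω | w.1 < hX.mk X ω ∧ w.2 < hY.mk Y ω} := by
      refine measure_congr (eventuallyEq_set.2 ?_)
      filter_upwards [hX.ae_eq_mk, hY.ae_eq_mk] with ω hXω hYω
      rw [hXω, hYω]
    simp only [hcongr]
    rw [← this hX.measurable_mk.aemeasurable hY.measurable_mk.aemeasurable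
      ⟨hX.measurable_mk, hY.measurable_mk⟩]
    refine lintegral_congr_ae ?_
    filter_upwards [hX.ae_eq_mk, hY.ae_eq_mk] with ω hXω hYω
    rw [hXω, hYω]
  obtain ⟨hX, hY⟩ := hmeas
  let quadrant : Measure (ℝ × ℝ) := volume.restrict (Ioi 0 ×ˢ Ioi 0)
  let A : Set (Ω × ℝ × ℝ) := {q | q.2.1 < X q.1} ∩ {q | q.2.2 < Y q.1}
  have hA : MeasurableSet A :=
    (measurableSet_lt (by fun_prop) (by fun_prop)).inter
      (measurableSet_lt (by fun_prop) (by fun_prop))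
  have hsection (ω : Ω) :
      quadrant (Prod.mk ω ⁻¹' A) = ENNReal.ofReal (X ω) * ENNReal.ofReal (Y ω) := by
    have hA_section : Prod.mk ω ⁻¹' A = Iio (X ω) ×ˢ Iio (Y ω) := rfl
    rw [hA_section, Measure.restrict_apply (measurableSet_Iio.prod measurableSet_Iio),
      prod_inter_prod, Measure.volume_eq_prod, Measure.prod_prod]
    simp [inter_comm (Iio _), Ioi_inter_Iio]
  calc ∫⁻ ω, ENNReal.ofReal (X ω) * ENNReal.ofReal (Y ω) ∂P
      = ∫⁻ ω, quadrant (Prod.mk ω ⁻¹' A) ∂P := by simp only [hsection]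
    _ = (P.prod quadrant) A := (Measure.prod_apply hA).symm
    _ = ∫⁻ w, P ((fun ω => (ω, w)) ⁻¹' A) ∂quadrant := Measure.prod_apply_symm hA

theorem lintegral_ofReal_mul_ofReal_le_of_monovaryOn [SFinite P] [SFinite P']
    (hX : IdentDistrib X X' P P') (hY : IdentDistrib Y Y' P P') (hs : ∀ᵐ ω ∂P', ω ∈ s)
    (h : MonovaryOn X' Y' s) :
    ∫⁻ ω, ENNReal.ofReal (X ω) * ENNReal.ofReal (Y ω) ∂P ≤
      ∫⁻ ω, ENNReal.ofReal (X' ω) * ENNReal.ofReal (Y' ω) ∂P' := by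
  rw [lintegral_ofReal_mul_ofReal_eq_lintegral_measure_lt_and_lt hX.aemeasurable_fst
    hY.aemeasurable_fst, lintegral_ofReal_mul_ofReal_eq_lintegral_measure_lt_and_lt
    hX.aemeasurable_snd hY.aemeasurable_snd]
  exact lintegral_mono fun w => measure_lt_and_lt_le_of_monovaryOn hX hY hs h w.1 w.2

theorem lintegral_ofReal_mul_ofReal_le_of_antivaryOn [IsFiniteMeasure P] [SFinite P']
    (hX : IdentDistrib X X' P P') (hY : IdentDistrib Y Y' P P') (hs : ∀ᵐ ω ∂P', ω ∈ s)
    (h : AntivaryOn X' Y' s) :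
    ∫⁻ ω, ENNReal.ofReal (X' ω) * ENNReal.ofReal (Y' ω) ∂P' ≤
      ∫⁻ ω, ENNReal.ofReal (X ω) * ENNReal.ofReal (Y ω) ∂P := by
  rw [lintegral_ofReal_mul_ofReal_eq_lintegral_measure_lt_and_lt hX.aemeasurable_fst
    hY.aemeasurable_fst, lintegral_ofReal_mul_ofReal_eq_lintegral_measure_lt_and_lt
    hX.aemeasurable_snd hY.aemeasurable_snd]
  exact lintegral_mono fun w => measure_lt_and_lt_le_of_antivaryOn hX hY hs h w.1 w.2

theorem ofReal_mul_eq_add (x y : ℝ) :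
    ENNReal.ofReal (x * y) = ENNReal.ofReal x * ENNReal.ofReal y +
      ENNReal.ofReal (-x) * ENNReal.ofReal (-y) := by
  rcases le_total 0 x with hx | hx
  · rw [ENNReal.ofReal_mul hx, ENNReal.ofReal_of_nonpos (neg_nonpos.2 hx), zero_mul, add_zero]
  · rw [← neg_mul_neg, ENNReal.ofReal_mul (neg_nonneg.2 hx), ENNReal.ofReal_of_nonpos hx, zero_mul,
      zero_add]

theorem lintegral_ofReal_mul (hX : AEMeasurable X P) (hY : AEMeasurable Y P) :
    ∫⁻ ω, ENNReal.ofReal (X ω * Y ω) ∂P =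
      (∫⁻ ω, ENNReal.ofReal (X ω) * ENNReal.ofReal (Y ω) ∂P) +
        ∫⁻ ω, ENNReal.ofReal (-X ω) * ENNReal.ofReal (-Y ω) ∂P := by
  simp only [ofReal_mul_eq_add]
  exact lintegral_add_left' (by fun_prop) _

theorem lintegral_ofReal_mul_le_of_monovaryOn [SFinite P] [SFinite P']
    (hX : IdentDistrib X X' P P') (hY : IdentDistrib Y Y' P P') (hs : ∀ᵐ ω ∂P', ω ∈ s)
    (h : MonovaryOn X' Y' s) :
    ∫⁻ ω, ENNReal.ofReal (X ω * Y ω) ∂P ≤ ∫⁻ ω, ENNReal.ofReal (X' ω * Y' ω) ∂P' := by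
  rw [lintegral_ofReal_mul hX.aemeasurable_fst hY.aemeasurable_fst,
    lintegral_ofReal_mul hX.aemeasurable_snd hY.aemeasurable_snd]
  exact add_le_add (lintegral_ofReal_mul_ofReal_le_of_monovaryOn hX hY hs h)
    (lintegral_ofReal_mul_ofReal_le_of_monovaryOn (hX.comp measurable_neg) (hY.comp measurable_neg)
      hs (monovaryOn_neg.2 h))

theorem lintegral_ofReal_mul_le_of_antivaryOn [IsFiniteMeasure P] [SFinite P']
    (hX : IdentDistrib X X' P P') (hY : IdentDistrib Y Y' P P') (hs : ∀ᵐ ω ∂P', ω ∈ s)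
    (h : AntivaryOn X' Y' s) :
    ∫⁻ ω, ENNReal.ofReal (X' ω * Y' ω) ∂P' ≤ ∫⁻ ω, ENNReal.ofReal (X ω * Y ω) ∂P := by
  rw [lintegral_ofReal_mul hX.aemeasurable_fst hY.aemeasurable_fst,
    lintegral_ofReal_mul hX.aemeasurable_snd hY.aemeasurable_snd]
  exact add_le_add (lintegral_ofReal_mul_ofReal_le_of_antivaryOn hX hY hs h)
    (lintegral_ofReal_mul_ofReal_le_of_antivaryOn (hX.comp measurable_neg) (hY.comp measurable_neg)
      hs (antivaryOn_neg.2 h))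

theorem expectation_le_expectation_of_lintegral_le {Z : Ω → ℝ} {Z' : Ω' → ℝ}
    (hpos : ∫⁻ ω, ENNReal.ofReal (Z ω) ∂P ≤ ∫⁻ ω, ENNReal.ofReal (Z' ω) ∂P')
    (hneg : ∫⁻ ω, ENNReal.ofReal (-Z' ω) ∂P' ≤ ∫⁻ ω, ENNReal.ofReal (-Z ω) ∂P) :
    expectation P Z ≤ expectation P' Z' :=
  EReal.sub_le_sub (EReal.coe_ennreal_le_coe_ennreal_iff.2 hpos)
    (EReal.coe_ennreal_le_coe_ennreal_iff.2 hneg)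

theorem expectation_mul_le_of_monovaryOn [IsFiniteMeasure P] [SFinite P']
    (hX : IdentDistrib X X' P P') (hY : IdentDistrib Y Y' P P') (hs : ∀ᵐ ω ∂P', ω ∈ s)
    (h : MonovaryOn X' Y' s) :
    expectation P (fun ω => X ω * Y ω) ≤ expectation P' (fun ω => X' ω * Y' ω) := by
  refine expectation_le_expectation_of_lintegral_le
    (lintegral_ofReal_mul_le_of_monovaryOn hX hY hs h) ?_
  simp only [← neg_mul]
  exact lintegral_ofReal_mul_le_of_antivaryOn (hX.comp measurable_neg) hY hs h.neg_left

theorem expectation_mul_le_of_antivaryOn [IsFiniteMeasure P] [SFinite P']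
    (hX : IdentDistrib X X' P P') (hY : IdentDistrib Y Y' P P') (hs : ∀ᵐ ω ∂P', ω ∈ s)
    (h : AntivaryOn X' Y' s) :
    expectation P' (fun ω => X' ω * Y' ω) ≤ expectation P (fun ω => X ω * Y ω) := by
  refine expectation_le_expectation_of_lintegral_le
    (lintegral_ofReal_mul_le_of_antivaryOn hX hY hs h) ?_
  simp only [← neg_mul]
  exact lintegral_ofReal_mul_le_of_monovaryOn (hX.comp measurable_neg) hY hs h.neg_left

end Rearrangement

section MixedMoment

variable {Ω : Type*} [MeasurableSpace Ω] {P : Measure Ω} {s : Set Ω}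

theorem HasExpectation.neg {Z : Ω → ℝ} (hZ : HasExpectation P Z) :
    HasExpectation P (fun ω => -Z ω) :=
  ⟨hZ.1.neg, by simpa only [neg_neg] using hZ.2.symm⟩

variable [IsProbabilityMeasure P]

theorem hasExpectation_mul_of_monovaryOn {X Y : Ω → ℝ} (hX : Integrable X P)
    (hY : Integrable Y P) (hs : ∀ᵐ ω ∂P, ω ∈ s) (h : MonovaryOn X Y s) :
    HasExpectation P (fun ω => X ω * Y ω) := by
  have hfst : IdentDistrib (fun z : Ω × Ω => X z.1) X (P.prod P) P :=
    (measurePreserving_fst.hasLaw.identDistrib HasLaw.id).comp_of_aemeasurable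
      (by simpa using hX.aemeasurable)
  have hsnd : IdentDistrib (fun z : Ω × Ω => Y z.2) Y (P.prod P) P :=
    (measurePreserving_snd.hasLaw.identDistrib HasLaw.id).comp_of_aemeasurable
      (by simpa using hY.aemeasurable)
  -- The negative part of a comonotone product is dominated by that of the independent coupling.
  have hle : ∫⁻ ω, ENNReal.ofReal (-(X ω * Y ω)) ∂P ≤
      ∫⁻ z, ENNReal.ofReal (-(X z.1 * Y z.2)) ∂P.prod P := by
    simp only [← neg_mul]
    exact lintegral_ofReal_mul_le_of_antivaryOn (hfst.comp measurable_neg) hsnd hs h.neg_left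
  exact ⟨hX.aemeasurable.mul hY.aemeasurable,
    Or.inr (hle.trans_lt (hX.mul_prod hY).neg.lintegral_lt_top).ne⟩

theorem hasExpectation_mul_of_antivaryOn {X Y : Ω → ℝ} (hX : Integrable X P)
    (hY : Integrable Y P) (hs : ∀ᵐ ω ∂P, ω ∈ s) (h : AntivaryOn X Y s) :
    HasExpectation P (fun ω => X ω * Y ω) := by
  simpa only [Pi.neg_apply, neg_mul, neg_neg] using
    (hasExpectation_mul_of_monovaryOn hX.neg hY hs h.neg_left).neg

variable {ν₁ ν₂ : Measure ℝ} {d : ℕ} {Y₁ Y₂ Z : Ω → ℝ}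

theorem hasMixedMoment_maxMixedMoment_of_monovaryOn (hY₁ : HasLaw Y₁ ν₁ P)
    (hY₂ : HasLaw Y₂ ν₂ P) (hint₁ : Integrable Y₁ P) (hint₂ : Integrable (fun ω => Y₂ ω ^ d) P)
    (hs : ∀ᵐ ω ∂P, ω ∈ s) (h : MonovaryOn Y₁ (fun ω => Y₂ ω ^ d) s) :
    HasMixedMoment P ν₁ ν₂ d Y₁ Y₂ (maxMixedMoment P ν₁ ν₂ d) := by
  have hexp := hasExpectation_mul_of_monovaryOn hint₁ hint₂ hs h
  refine ⟨hY₁, hY₂, hexp, le_antisymm (le_sSup ⟨Y₁, Y₂, hY₁, hY₂, hexp, rfl⟩) (sSup_le ?_)⟩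
  rintro _ ⟨W₁, W₂, hW₁, hW₂, -, rfl⟩
  exact expectation_mul_le_of_monovaryOn (hW₁.identDistrib hY₁) (hW₂.identDistrib hY₂).pow hs h

theorem hasMixedMoment_minMixedMoment_of_antivaryOn (hY₁ : HasLaw Y₁ ν₁ P)
    (hY₂ : HasLaw Y₂ ν₂ P) (hint₁ : Integrable Y₁ P) (hint₂ : Integrable (fun ω => Y₂ ω ^ d) P)
    (hs : ∀ᵐ ω ∂P, ω ∈ s) (h : AntivaryOn Y₁ (fun ω => Y₂ ω ^ d) s) :
    HasMixedMoment P ν₁ ν₂ d Y₁ Y₂ (minMixedMoment P ν₁ ν₂ d) := by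
  have hexp := hasExpectation_mul_of_antivaryOn hint₁ hint₂ hs h
  refine ⟨hY₁, hY₂, hexp, le_antisymm (le_sInf ?_) (sInf_le ⟨Y₁, Y₂, hY₁, hY₂, hexp, rfl⟩)⟩
  rintro _ ⟨W₁, W₂, hW₁, hW₂, -, rfl⟩
  exact expectation_mul_le_of_antivaryOn (hW₁.identDistrib hY₁) (hW₂.identDistrib hY₂).pow hs h

theorem maxMixedMoment_eq_expectation_of_monovaryOn (hY₁ : HasLaw Y₁ ν₁ P)
    (hY₂ : HasLaw Y₂ ν₂ P) (hZ : IdentDistrib (fun ω => Y₂ ω ^ d) Z P P)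
    (hint₁ : Integrable Y₁ P) (hint₂ : Integrable (fun ω => Y₂ ω ^ d) P)
    (hs : ∀ᵐ ω ∂P, ω ∈ s) (h : MonovaryOn Y₁ (fun ω => Y₂ ω ^ d) s) (hYZ : MonovaryOn Y₁ Z s) :
    maxMixedMoment P ν₁ ν₂ d = expectation P (fun ω => Y₁ ω * Z ω) := by
  have hY₁' := IdentDistrib.refl hY₁.aemeasurable
  rw [← (hasMixedMoment_maxMixedMoment_of_monovaryOn hY₁ hY₂ hint₁ hint₂ hs h).2.2.2]
  exact le_antisymm (expectation_mul_le_of_monovaryOn hY₁' hZ hs hYZ)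
    (expectation_mul_le_of_monovaryOn hY₁' hZ.symm hs h)

theorem minMixedMoment_eq_expectation_of_antivaryOn (hY₁ : HasLaw Y₁ ν₁ P)
    (hY₂ : HasLaw Y₂ ν₂ P) (hZ : IdentDistrib (fun ω => Y₂ ω ^ d) Z P P)
    (hint₁ : Integrable Y₁ P) (hint₂ : Integrable (fun ω => Y₂ ω ^ d) P)
    (hs : ∀ᵐ ω ∂P, ω ∈ s) (h : AntivaryOn Y₁ (fun ω => Y₂ ω ^ d) s) (hYZ : AntivaryOn Y₁ Z s) :
    minMixedMoment P ν₁ ν₂ d = expectation P (fun ω => Y₁ ω * Z ω) := by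
  have hY₁' := IdentDistrib.refl hY₁.aemeasurable
  rw [← (hasMixedMoment_minMixedMoment_of_antivaryOn hY₁ hY₂ hint₁ hint₂ hs h).2.2.2]
  exact le_antisymm (expectation_mul_le_of_antivaryOn hY₁' hZ.symm hs h)
    (expectation_mul_le_of_antivaryOn hY₁' hZ hs hYZ)

end MixedMoment

section Quantile

theorem uniform01_eq_restrict_Ioo : uniform01 = volume.restrict (Ioo (0 : ℝ) 1) :=
  (Measure.restrict_congr_set Ioo_ae_eq_Icc).symm

instance : IsProbabilityMeasure uniform01 := ⟨by simp [uniform01]⟩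

theorem ae_mem_Ioo_uniform01 : ∀ᵐ u ∂uniform01, u ∈ Ioo (0 : ℝ) 1 := by
  rw [uniform01_eq_restrict_Ioo]
  exact ae_restrict_mem measurableSet_Ioo

theorem ae_mem_Ioo_of_hasLaw_uniform01 {Ω : Type*} [MeasurableSpace Ω] {P : Measure Ω} {U : Ω → ℝ}
    (hU : HasLaw U uniform01 P) : ∀ᵐ ω ∂P, U ω ∈ Ioo (0 : ℝ) 1 :=
  (hU.ae_iff measurableSet_Ioo.mem).2 ae_mem_Ioo_uniform01

theorem hasLaw_one_sub_uniform01 : HasLaw (fun u => 1 - u) uniform01 uniform01 := by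
  have h := (Measure.measurePreserving_sub_left (volume : Measure ℝ) 1).restrict_preimage
    (measurableSet_Icc (a := 0) (b := 1))
  rw [preimage_const_sub_Icc, sub_self, sub_zero] at h
  exact h.hasLaw

theorem uniform01_Iic {x : ℝ} (hx : x ∈ Icc (0 : ℝ) 1) :
    uniform01 (Iic x) = ENNReal.ofReal x := by
  rw [uniform01, Measure.restrict_apply measurableSet_Iic, inter_comm, ← Ici_inter_Iic,
    inter_assoc, Iic_inter_Iic, inf_eq_right.2 hx.2, Ici_inter_Iic, Real.volume_Icc, sub_zero]

theorem uniform01_Ioi {x : ℝ} (hx : x ∈ Icc (0 : ℝ) 1) :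
    uniform01 (Ioi x) = ENNReal.ofReal (1 - x) := by
  rw [← compl_Iic, prob_compl_eq_one_sub measurableSet_Iic, uniform01_Iic hx,
    ENNReal.ofReal_sub 1 hx.1, ENNReal.ofReal_one]

variable (ν : Measure ℝ)

theorem bddBelow_setOf_le_cdf {p : ℝ} (hp : 0 < p) : BddBelow {x | p ≤ cdf ν x} := by
  obtain ⟨b, hb⟩ := ((tendsto_cdf_atBot ν).eventually_lt_const hp).exists
  exact ⟨b, fun y hy => le_of_not_gt fun hyb =>
    (hb.trans_le hy).not_ge (monotone_cdf ν hyb.le)⟩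

theorem le_cdf_quantile {p : ℝ} (hp : p ∈ Ioo (0 : ℝ) 1) :
    p ≤ cdf ν (quantile (cdf ν) p) := by
  have hne : {x | p ≤ cdf ν x}.Nonempty := ((tendsto_cdf_atTop ν).eventually_const_le hp.2).exists
  have hright : Tendsto (cdf ν) (𝓝[>] quantile (cdf ν) p) (𝓝 (cdf ν (quantile (cdf ν) p))) :=
    ((cdf ν).right_continuous _).mono_left (nhdsWithin_mono _ Ioi_subset_Ici_self)
  refine ge_of_tendsto hright ?_
  filter_upwards [self_mem_nhdsWithin] with y hy
  obtain ⟨x, hx, hxy⟩ := exists_lt_of_csInf_lt hne hy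
  exact hx.trans (monotone_cdf ν hxy.le)

theorem quantile_cdf_le_iff {p x : ℝ} (hp : p ∈ Ioo (0 : ℝ) 1) :
    quantile (cdf ν) p ≤ x ↔ p ≤ cdf ν x :=
  ⟨fun h => (le_cdf_quantile ν hp).trans (monotone_cdf ν h),
    fun h => csInf_le (bddBelow_setOf_le_cdf ν hp.1) h⟩

theorem monotoneOn_quantile_cdf : MonotoneOn (quantile (cdf ν)) (Ioo 0 1) :=
  fun _ hp _ hq hpq => (quantile_cdf_le_iff ν hp).2 (hpq.trans (le_cdf_quantile ν hq))

theorem antitoneOn_quantile_cdf_one_sub :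
    AntitoneOn (fun p => quantile (cdf ν) (1 - p)) (Ioo 0 1) :=
  fun _ hp _ hq hpq => monotoneOn_quantile_cdf ν ⟨sub_pos.2 hq.2, sub_lt_self 1 hq.1⟩
    ⟨sub_pos.2 hp.2, sub_lt_self 1 hp.1⟩ (sub_le_sub_left hpq 1)

theorem hasLaw_quantile_cdf [IsProbabilityMeasure ν] :
    HasLaw (quantile (cdf ν)) ν uniform01 := by
  have hmeas : AEMeasurable (quantile (cdf ν)) uniform01 := by
    rw [uniform01_eq_restrict_Ioo]
    exact aemeasurable_restrict_of_monotoneOn measurableSet_Ioo (monotoneOn_quantile_cdf ν)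
  have := Measure.isProbabilityMeasure_map hmeas
  refine ⟨hmeas, Measure.ext_of_Iic _ _ fun x => ?_⟩
  have hpre : quantile (cdf ν) ⁻¹' Iic x =ᵐ[uniform01] Iic (cdf ν x) :=
    eventuallyEq_set.2 (ae_mem_Ioo_uniform01.mono fun u hu => quantile_cdf_le_iff ν hu)
  rw [Measure.map_apply_of_aemeasurable hmeas measurableSet_Iic, measure_congr hpre,
    uniform01_Iic ⟨cdf_nonneg ν x, cdf_le_one ν x⟩, ofReal_cdf]

end Quantile

section ShiftedExponential

/-- The law of `X - a` for an exponential random variable `X` with rate `lam`, that is, the law of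
`X₂` when `X₂ + a ∼ Exp(lam)`. -/
noncomputable def shiftedExp (lam a : ℝ) : Measure ℝ := (expMeasure lam).map fun x => x - a

variable {lam : ℝ} (hlam : 0 < lam) (a : ℝ)

theorem hasLaw_sub_shiftedExp : HasLaw (fun x => x - a) (shiftedExp lam a) (expMeasure lam) :=
  ⟨by fun_prop, rfl⟩

theorem hasLaw_shiftedExp_of_hasLaw_add {Ω : Type*} [MeasurableSpace Ω] {P : Measure Ω}
    {X : Ω → ℝ} (hX : HasLaw (fun ω => X ω + a) (expMeasure lam) P) :
    HasLaw X (shiftedExp lam a) P := by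
  simpa only [add_sub_cancel_right] using (hasLaw_sub_shiftedExp a).fun_comp hX

include hlam

theorem isProbabilityMeasure_shiftedExp : IsProbabilityMeasure (shiftedExp lam a) :=
  (hasLaw_sub_shiftedExp a).isProbabilityMeasure_iff.1 (isProbabilityMeasure_expMeasure hlam)

theorem cdf_shiftedExp (x : ℝ) :
    cdf (shiftedExp lam a) x = if -a ≤ x then 1 - Real.exp (-(lam * (x + a))) else 0 := by
  have := isProbabilityMeasure_expMeasure hlam
  have := isProbabilityMeasure_shiftedExp hlam a
  have hpre : (fun y => y - a) ⁻¹' Iic x = Iic (x + a) := preimage_sub_const_Iic a x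
  simp only [neg_le_iff_add_nonneg]
  rw [← cdf_expMeasure_eq hlam, cdf_eq_real, cdf_eq_real, shiftedExp,
    map_measureReal_apply (by fun_prop) measurableSet_Iic, hpre]

theorem quantile_shiftedExp {p : ℝ} (hp : p ∈ Ioo (0 : ℝ) 1) :
    quantile (cdf (shiftedExp lam a)) p = -Real.log (1 - p) / lam - a := by
  refine eq_of_forall_ge_iff fun x => ?_
  have hlog : Real.log (1 - p) < 0 := Real.log_neg (sub_pos.2 hp.2) (by linarith [hp.1])
  rw [quantile_cdf_le_iff _ hp, cdf_shiftedExp hlam, sub_le_iff_le_add, div_le_iff₀ hlam]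
  split_ifs with hx
  · rw [le_sub_comm, ← Real.le_log_iff_exp_le (sub_pos.2 hp.2), neg_le, mul_comm]
  · refine iff_of_false hp.1.not_ge (not_le.2 ?_)
    nlinarith

theorem quantile_shiftedExp_nonneg {p : ℝ} (hp : p ∈ Ioo (0 : ℝ) 1)
    (h : (1 - p) ^ 2 ≤ Real.exp (-2 * a * lam)) : 0 ≤ quantile (cdf (shiftedExp lam a)) p := by
  have hlog : 2 * Real.log (1 - p) ≤ -2 * a * lam := by
    simpa using (Real.log_le_iff_le_exp (pow_pos (sub_pos.2 hp.2) 2)).2 h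
  rw [quantile_shiftedExp hlam a hp, sub_nonneg, le_div_iff₀ hlam]
  linarith

theorem cdf_shiftedExp_self_lt_iff {u : ℝ} (hu : 0 < u) :
    cdf (shiftedExp lam a) a < u ↔ 1 - Real.exp (-2 * a * lam) < u := by
  rw [cdf_shiftedExp hlam]
  split_ifs with ha
  · rw [show -(lam * (a + a)) = -2 * a * lam by ring]
  · have hexp : 1 ≤ Real.exp (-2 * a * lam) := Real.one_le_exp (by nlinarith)
    exact iff_of_true hu (by linarith)

theorem quantile_shiftedExp_eq_neg {p q : ℝ} (hp : p ∈ Ioo (0 : ℝ) 1) (hq : q ∈ Ioo (0 : ℝ) 1)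
    (h : (1 - p) * (1 - q) = Real.exp (-2 * a * lam)) :
    quantile (cdf (shiftedExp lam a)) q = -quantile (cdf (shiftedExp lam a)) p := by
  have hlog : Real.log (1 - p) + Real.log (1 - q) = -2 * a * lam := by
    rw [← Real.log_mul (sub_pos.2 hp.2).ne' (sub_pos.2 hq.2).ne', h, Real.log_exp]
  rw [quantile_shiftedExp hlam a hp, quantile_shiftedExp hlam a hq]
  field_simp
  linarith

theorem integrable_pow_expMeasure (n : ℕ) : Integrable (fun x : ℝ => x ^ n) (expMeasure lam) := by
  have hpdf : Measurable (exponentialPDF lam) := (measurable_exponentialPDFReal lam).ennreal_ofReal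
  have hn : (-1 : ℝ) < n := by linarith [n.cast_nonneg (α := ℝ)]
  have hgamma := ((integrableOn_rpow_mul_exp_neg_mul_rpow hn one_pos hlam).const_mul lam)
  rw [← IntegrableOn, ← integrableOn_Ici_iff_integrableOn_Ioi,
    ← integrable_indicator_iff measurableSet_Ici] at hgamma
  change Integrable _ (volume.withDensity (exponentialPDF lam))
  rw [integrable_withDensity_iff hpdf (.of_forall fun x => ENNReal.ofReal_lt_top)]
  refine hgamma.congr (.of_forall fun x => ?_)
  simp only [exponentialPDF_eq, indicator, mem_Ici]
  split_ifs with hx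
  · rw [ENNReal.toReal_ofReal (by positivity), Real.rpow_natCast, Real.rpow_one, neg_mul]
    ring
  · simp

theorem integrable_pow_shiftedExp (n : ℕ) :
    Integrable (fun x : ℝ => x ^ n) (shiftedExp lam a) := by
  refine (integrable_map_measure (by fun_prop) (by fun_prop)).2 ?_
  simp only [Function.comp_def, sub_eq_add_neg, add_pow]
  exact integrable_finsetSum _ fun k _ =>
    ((integrable_pow_expMeasure hlam k).mul_const _).mul_const _

theorem integrable_pow_of_hasLaw_shiftedExp {Ω : Type*} [MeasurableSpace Ω] {P : Measure Ω}
    {X : Ω → ℝ} (hX : HasLaw X (shiftedExp lam a) P) (n : ℕ) :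
    Integrable (fun ω => X ω ^ n) P :=
  (hX.map_eq ▸ integrable_pow_shiftedExp hlam a n).comp_aemeasurable hX.aemeasurable

end ShiftedExponential

section Branches

/-- The larger of the two values of `U₂` given `U = u ≤ F₂(a)`, taken when `J = 1`. -/
noncomputable def upperBranch (lam a u : ℝ) : ℝ := 1 + (u - expRoot lam a u) / 2

/-- The smaller of the two values of `U₂` given `U = u ≤ F₂(a)`, taken when `J = 0`. -/
noncomputable def lowerBranch (lam a u : ℝ) : ℝ := 1 - (u + expRoot lam a u) / 2

/-- The level `p` for which the `p`-quantile of `X₂` is the `u`-quantile of `|X₂|`, where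
`X₂ + a ∼ Exp(lam)`. The maximum selects `upperBranch` for `u < 1 - e^{-2aλ}` and `u` above. -/
noncomputable def absLevel (lam a u : ℝ) : ℝ := max u (upperBranch lam a u)

variable (lam a u : ℝ)

theorem expRoot_sq : expRoot lam a u ^ 2 = u ^ 2 + 4 * Real.exp (-2 * a * lam) :=
  Real.sq_sqrt (by positivity)

theorem expRoot_pos : 0 < expRoot lam a u := Real.sqrt_pos.2 (by positivity)

theorem abs_lt_expRoot : |u| < expRoot lam a u :=
  Real.lt_sqrt_of_sq_lt (by rw [sq_abs]; linarith [Real.exp_pos (-2 * a * lam)])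

theorem upperBranch_sub_lowerBranch : upperBranch lam a u - lowerBranch lam a u = u := by
  rw [upperBranch, lowerBranch]
  ring

theorem one_sub_upperBranch_mul_one_sub_lowerBranch :
    (1 - upperBranch lam a u) * (1 - lowerBranch lam a u) = Real.exp (-2 * a * lam) := by
  rw [upperBranch, lowerBranch]
  linarith [expRoot_sq lam a u]

theorem upperBranch_lt_one : upperBranch lam a u < 1 := by
  rw [upperBranch]
  linarith [(abs_lt.1 (abs_lt_expRoot lam a u)).2]

theorem upperBranch_zero : upperBranch lam a 0 = lowerBranch lam a 0 := by
  simpa [sub_eq_zero] using upperBranch_sub_lowerBranch lam a 0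

theorem lowerBranch_one_sub_exp : lowerBranch lam a (1 - Real.exp (-2 * a * lam)) = 0 := by
  have hroot : expRoot lam a (1 - Real.exp (-2 * a * lam)) = 1 + Real.exp (-2 * a * lam) :=
    Real.sqrt_eq_iff_mul_self_eq_of_pos (by positivity) |>.2 (by ring)
  rw [lowerBranch, hroot]
  ring

theorem upperBranch_one_sub_exp :
    upperBranch lam a (1 - Real.exp (-2 * a * lam)) = 1 - Real.exp (-2 * a * lam) := by
  simpa only [lowerBranch_one_sub_exp, sub_zero] using
    upperBranch_sub_lowerBranch lam a (1 - Real.exp (-2 * a * lam))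

theorem mixProb_eq : mixProb lam a u = (1 + u / expRoot lam a u) / 2 := by
  have hR := expRoot_pos lam a u
  obtain ⟨hadd, hsub⟩ := abs_lt.1 (abs_lt_expRoot lam a u)
  have hfactor : 4 * Real.exp (-2 * a * lam) = (expRoot lam a u - u) * (expRoot lam a u + u) := by
    linarith [expRoot_sq lam a u]
  rw [mixProb, hfactor]
  generalize expRoot lam a u = R at *
  have hx : 0 < R - u := sub_pos.2 hsub
  have hy : 0 < R + u := by linarith
  have hplus : (R - u) * (R + u) / (u + R) ^ 2 = (R - u) / (R + u) := by
    rw [add_comm u, sq, mul_div_mul_right _ _ hy.ne']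
  have hminus : (R - u) * (R + u) / (u - R) ^ 2 = (R + u) / (R - u) := by
    rw [sub_sq_comm u, sq, mul_div_mul_left _ _ hx.ne']
  have hsum : 2 + (R - u) / (R + u) + (R + u) / (R - u) =
      2 * R / (R + u) * (1 + (R + u) / (R - u)) := by
    field_simp
    ring
  rw [hplus, hminus, hsum, div_mul_cancel_right₀ (by positivity), inv_div, one_add_div hR.ne',
    div_div, mul_comm R]

theorem mixProb_mem_Ioo : mixProb lam a u ∈ Ioo (0 : ℝ) 1 := by
  have h := abs_lt_expRoot lam a u
  have hdiv : |u / expRoot lam a u| < 1 := by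
    rwa [abs_div, abs_of_pos (expRoot_pos lam a u), div_lt_one (expRoot_pos lam a u)]
  rw [mixProb_eq]
  constructor <;> linarith [abs_lt.1 hdiv]

theorem hasDerivAt_expRoot : HasDerivAt (expRoot lam a) (u / expRoot lam a u) u := by
  have h := ((hasDerivAt_pow 2 u).add_const (4 * Real.exp (-2 * a * lam))).sqrt (by positivity)
  rwa [Nat.cast_ofNat, Nat.add_one_sub_one, pow_one, mul_div_mul_left _ _ two_ne_zero] at h

theorem hasDerivAt_upperBranch : HasDerivAt (upperBranch lam a) (1 - mixProb lam a u) u := by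
  rw [mixProb_eq, show 1 - (1 + u / expRoot lam a u) / 2 = (1 - u / expRoot lam a u) / 2 by ring]
  exact (((hasDerivAt_id' u).sub (hasDerivAt_expRoot lam a u)).div_const 2).const_add 1

theorem hasDerivAt_lowerBranch : HasDerivAt (lowerBranch lam a) (-mixProb lam a u) u := by
  rw [mixProb_eq]
  exact (((hasDerivAt_id' u).add (hasDerivAt_expRoot lam a u)).div_const 2).const_sub 1

theorem strictMono_upperBranch : StrictMono (upperBranch lam a) :=
  strictMono_of_hasDerivAt_pos (hasDerivAt_upperBranch lam a)
    fun u => sub_pos.2 (mixProb_mem_Ioo lam a u).2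

theorem strictAnti_lowerBranch : StrictAnti (lowerBranch lam a) :=
  strictAnti_of_hasDerivAt_neg (hasDerivAt_lowerBranch lam a)
    fun u => neg_neg_of_pos (mixProb_mem_Ioo lam a u).1

theorem continuous_upperBranch : Continuous (upperBranch lam a) :=
  continuous_iff_continuousAt.2 fun u => (hasDerivAt_upperBranch lam a u).continuousAt

theorem continuous_lowerBranch : Continuous (lowerBranch lam a) :=
  continuous_iff_continuousAt.2 fun u => (hasDerivAt_lowerBranch lam a u).continuousAt

variable {u} {a}

theorem lowerBranch_pos_iff : 0 < lowerBranch lam a u ↔ u < 1 - Real.exp (-2 * a * lam) := by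
  rw [← lowerBranch_one_sub_exp lam a, (strictAnti_lowerBranch lam a).lt_iff_gt]

theorem setLIntegral_upperBranch (g : ℝ → ENNReal) (b c : ℝ) :
    ∫⁻ u in Ioo b c, ENNReal.ofReal (1 - mixProb lam a u) * g (upperBranch lam a u) =
      ∫⁻ w in Ioo (upperBranch lam a b) (upperBranch lam a c), g w := by
  have hmono := strictMono_upperBranch lam a
  rw [← (continuous_upperBranch lam a).image_Ioo_of_strictMono hmono,
    lintegral_image_eq_lintegral_deriv_mul_of_monotoneOn measurableSet_Ioo
      (fun u _ => (hasDerivAt_upperBranch lam a u).hasDerivWithinAt) (hmono.monotone.monotoneOn _)]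

theorem setLIntegral_lowerBranch (g : ℝ → ENNReal) {b c : ℝ} (hbc : b ≤ c) :
    ∫⁻ u in Ioo b c, ENNReal.ofReal (mixProb lam a u) * g (lowerBranch lam a u) =
      ∫⁻ w in Ioo (lowerBranch lam a c) (lowerBranch lam a b), g w := by
  have hanti := strictAnti_lowerBranch lam a
  rw [← (continuous_lowerBranch lam a).continuousOn.image_Ioo_of_strictAntiOn hbc
      (hanti.strictAntiOn _),
    lintegral_image_eq_lintegral_deriv_mul_of_antitoneOn measurableSet_Ioo
      (fun u _ => (hasDerivAt_lowerBranch lam a u).hasDerivWithinAt)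
      (hanti.antitone.antitoneOn _)]
  simp only [neg_neg]

end Branches

section MixtureLaw

theorem setLIntegral_Ioo_add_Ioo (g : ℝ → ENNReal) {a b c : ℝ} (hab : a ≤ b) (hbc : b ≤ c) :
    (∫⁻ u in Ioo a b, g u) + ∫⁻ u in Ioo b c, g u = ∫⁻ u in Ioo a c, g u := by
  rw [setLIntegral_congr Ioo_ae_eq_Ioc, setLIntegral_congr (s := Ioo b c) Ioo_ae_eq_Ioc,
    setLIntegral_congr (s := Ioo a c) Ioo_ae_eq_Ioc, ← Ioc_union_Ioc_eq_Ioc hab hbc,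
    lintegral_union measurableSet_Ioc (Ioc_disjoint_Ioc_of_le le_rfl)]

variable (F : ℝ → ℝ) (lam a : ℝ)

theorem mixU₂_eq_ite (u v : ℝ) :
    mixU₂ F lam a u v = if F a < u then u else
      if mixProb lam a u < v then upperBranch lam a u else lowerBranch lam a u := by
  unfold mixU₂ upperBranch lowerBranch
  split_ifs <;> simp

theorem measurable_mixProb : Measurable (mixProb lam a) := by
  unfold mixProb expRoot
  fun_prop

theorem measurable_mixU₂ : Measurable fun z : ℝ × ℝ => mixU₂ F lam a z.1 z.2 := by
  have hprob := measurable_mixProb lam a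
  have hup := (continuous_upperBranch lam a).measurable
  have hlow := (continuous_lowerBranch lam a).measurable
  simp only [mixU₂_eq_ite]
  exact .ite (measurableSet_lt (by fun_prop) (by fun_prop)) (by fun_prop)
    (.ite (measurableSet_lt (by fun_prop) (by fun_prop)) (by fun_prop) (by fun_prop))

theorem lintegral_mixU₂ (g : ℝ → ENNReal) (u : ℝ) :
    ∫⁻ v, g (mixU₂ F lam a u v) ∂uniform01 = if F a < u then g u else
      ENNReal.ofReal (mixProb lam a u) * g (lowerBranch lam a u) +
        ENNReal.ofReal (1 - mixProb lam a u) * g (upperBranch lam a u) := by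
  simp only [mixU₂_eq_ite]
  split_ifs
  · rw [lintegral_const, measure_univ, mul_one]
  · have hp : mixProb lam a u ∈ Icc (0 : ℝ) 1 := Ioo_subset_Icc_self (mixProb_mem_Ioo lam a u)
    rw [← lintegral_add_compl _ (measurableSet_Iic (a := mixProb lam a u)), compl_Iic,
      setLIntegral_congr_fun (g := fun _ => g (lowerBranch lam a u)) measurableSet_Iic
        fun v hv => congrArg g (if_neg (not_lt.2 (mem_Iic.1 hv))),
      setLIntegral_congr_fun (g := fun _ => g (upperBranch lam a u)) measurableSet_Ioi
        fun v hv => congrArg g (if_pos (mem_Ioi.1 hv)),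
      setLIntegral_const, setLIntegral_const, uniform01_Iic hp, uniform01_Ioi hp, mul_comm,
      mul_comm (g _)]

variable {F lam a}

theorem setLIntegral_lintegral_mixU₂ (hFa₀ : 0 ≤ F a) (hFa : F a = 1 - Real.exp (-2 * a * lam))
    {g : ℝ → ENNReal} (hg : Measurable g) :
    ∫⁻ u in Ioo 0 (F a), ∫⁻ v, g (mixU₂ F lam a u v) ∂uniform01 = ∫⁻ u in Ioo 0 (F a), g u := by
  have hlow : lowerBranch lam a (F a) = 0 := hFa ▸ lowerBranch_one_sub_exp lam a
  have hup : upperBranch lam a (F a) = F a := hFa ▸ upperBranch_one_sub_exp lam a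
  have hlow₀ : 0 ≤ lowerBranch lam a 0 :=
    hlow.ge.trans ((strictAnti_lowerBranch lam a).antitone hFa₀)
  have hup₀ : lowerBranch lam a 0 ≤ F a :=
    (upperBranch_zero lam a).ge.trans (((strictMono_upperBranch lam a).monotone hFa₀).trans_eq hup)
  have hmeas : Measurable fun u => ENNReal.ofReal (mixProb lam a u) * g (lowerBranch lam a u) :=
    (measurable_mixProb lam a).ennreal_ofReal.mul
      (hg.comp (continuous_lowerBranch lam a).measurable)
  rw [setLIntegral_congr_fun measurableSet_Ioo fun u hu =>
      (lintegral_mixU₂ F lam a g u).trans (if_neg hu.2.not_gt),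
    lintegral_add_left hmeas, setLIntegral_lowerBranch lam g hFa₀, setLIntegral_upperBranch,
    hlow, hup, upperBranch_zero, setLIntegral_Ioo_add_Ioo g hlow₀ hup₀]

theorem lintegral_lintegral_mixU₂ (hFa₀ : 0 ≤ F a) (hFa : F a = 1 - Real.exp (-2 * a * lam))
    {g : ℝ → ENNReal} (hg : Measurable g) :
    ∫⁻ u, ∫⁻ v, g (mixU₂ F lam a u v) ∂uniform01 ∂uniform01 = ∫⁻ u, g u ∂uniform01 := by
  have hFa₁ : F a ≤ 1 := by linarith [Real.exp_pos (-2 * a * lam)]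
  have habove : ∫⁻ u in Ioo (F a) 1, ∫⁻ v, g (mixU₂ F lam a u v) ∂uniform01 =
      ∫⁻ u in Ioo (F a) 1, g u :=
    setLIntegral_congr_fun measurableSet_Ioo fun u hu =>
      (lintegral_mixU₂ F lam a g u).trans (if_pos hu.1)
  calc ∫⁻ u, ∫⁻ v, g (mixU₂ F lam a u v) ∂uniform01 ∂uniform01
      = ∫⁻ u in Ioo 0 1, ∫⁻ v, g (mixU₂ F lam a u v) ∂uniform01 := by
        rw [← uniform01_eq_restrict_Ioo]
    _ = ∫⁻ u in Ioo 0 1, g u := by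
        rw [← setLIntegral_Ioo_add_Ioo _ hFa₀ hFa₁, setLIntegral_lintegral_mixU₂ hFa₀ hFa hg,
          habove, setLIntegral_Ioo_add_Ioo g hFa₀ hFa₁]
    _ = ∫⁻ u, g u ∂uniform01 := by rw [← uniform01_eq_restrict_Ioo]

theorem hasLaw_mixU₂_prod (hFa₀ : 0 ≤ F a) (hFa : F a = 1 - Real.exp (-2 * a * lam)) :
    HasLaw (fun z : ℝ × ℝ => mixU₂ F lam a z.1 z.2) uniform01 (uniform01.prod uniform01) := by
  have hmeas := measurable_mixU₂ F lam a
  refine ⟨hmeas.aemeasurable, Measure.ext_of_lintegral _ fun g hg => ?_⟩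
  rw [lintegral_map hg hmeas, ← lintegral_lintegral_mixU₂ hFa₀ hFa hg]
  exact lintegral_prod _ (hg.comp hmeas).aemeasurable

theorem hasLaw_mixU₂ {Ω : Type*} [MeasurableSpace Ω] {P : Measure Ω}
    {U V : Ω → ℝ} (hlam : 0 < lam) (hU : HasLaw U uniform01 P) (hV : HasLaw V uniform01 P)
    (hUV : IndepFun U V P) :
    HasLaw (fun ω => mixU₂ (cdf (shiftedExp lam a)) lam a (U ω) (V ω)) uniform01 P := by
  rcases le_or_gt a 0 with ha | ha
  · refine hU.congr ?_
    filter_upwards [ae_mem_Ioo_of_hasLaw_uniform01 hU] with ω hω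
    rw [mixU₂_eq_ite, if_pos]
    refine (cdf_shiftedExp_self_lt_iff hlam a hω.1).2 ?_
    linarith [hω.1, Real.one_le_exp (show 0 ≤ -2 * a * lam by nlinarith)]
  · have hcdf : cdf (shiftedExp lam a) a = 1 - Real.exp (-2 * a * lam) := by
      rw [cdf_shiftedExp hlam, if_pos (by linarith)]
      ring_nf
    have := hU.isProbabilityMeasure_iff.2 inferInstance
    exact (hasLaw_mixU₂_prod (cdf_nonneg _ _) hcdf).fun_comp (hUV.hasLaw_prod hU hV)

end MixtureLaw

section AbsoluteValue

variable (lam a : ℝ)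

theorem monotone_absLevel : Monotone (absLevel lam a) :=
  monotone_id.max (strictMono_upperBranch lam a).monotone

theorem absLevel_mem_Ioo {u : ℝ} (hu : u ∈ Ioo (0 : ℝ) 1) : absLevel lam a u ∈ Ioo (0 : ℝ) 1 :=
  ⟨hu.1.trans_le (le_max_left _ _), max_lt hu.2 (upperBranch_lt_one lam a u)⟩

variable {lam} (hlam : 0 < lam)

include hlam

theorem quantile_absLevel_nonneg {u : ℝ} (hu : u ∈ Ioo (0 : ℝ) 1) :
    0 ≤ quantile (cdf (shiftedExp lam a)) (absLevel lam a u) := by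
  have hmem := absLevel_mem_Ioo lam a hu
  have hup : upperBranch lam a u ≤ absLevel lam a u := le_max_right _ _
  have hlow : lowerBranch lam a u ≤ absLevel lam a u := by
    linarith [upperBranch_sub_lowerBranch lam a u, hu.1]
  refine quantile_shiftedExp_nonneg hlam a hmem ?_
  rw [sq, ← one_sub_upperBranch_mul_one_sub_lowerBranch]
  exact mul_le_mul (by linarith) (by linarith) (by linarith [hmem.2])
    (by linarith [upperBranch_lt_one lam a u])

theorem monotoneOn_quantile_absLevel_pow (d : ℕ) :
    MonotoneOn (fun u => quantile (cdf (shiftedExp lam a)) (absLevel lam a u) ^ d) (Ioo 0 1) :=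
  fun _ hu _ hv huv => pow_le_pow_left₀ (quantile_absLevel_nonneg a hlam hu)
    (monotoneOn_quantile_cdf _ (absLevel_mem_Ioo lam a hu) (absLevel_mem_Ioo lam a hv)
      (monotone_absLevel lam a huv)) d

theorem quantile_lowerBranch {u : ℝ} (hu : u ∈ Ioo 0 (1 - Real.exp (-2 * a * lam))) :
    quantile (cdf (shiftedExp lam a)) (lowerBranch lam a u) =
      -quantile (cdf (shiftedExp lam a)) (upperBranch lam a u) := by
  have hpos := (lowerBranch_pos_iff lam).2 hu.2
  have hsub := upperBranch_sub_lowerBranch lam a u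
  have hlt := upperBranch_lt_one lam a u
  exact quantile_shiftedExp_eq_neg hlam a ⟨by linarith [hu.1], hlt⟩
    ⟨hpos, by linarith [hu.1]⟩ (one_sub_upperBranch_mul_one_sub_lowerBranch lam a u)

theorem quantile_mixU₂_pow_of_even {d : ℕ} (hd : Even d) {u : ℝ} (hu : 0 < u)
    (hne : u ≠ 1 - Real.exp (-2 * a * lam)) (v : ℝ) :
    quantile (cdf (shiftedExp lam a)) (mixU₂ (cdf (shiftedExp lam a)) lam a u v) ^ d =
      quantile (cdf (shiftedExp lam a)) (absLevel lam a u) ^ d := by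
  have hsub := upperBranch_sub_lowerBranch lam a u
  have hpos_iff := lowerBranch_pos_iff lam (a := a) (u := u)
  rw [mixU₂_eq_ite]
  simp only [cdf_shiftedExp_self_lt_iff hlam a hu]
  rcases lt_or_gt_of_ne hne with hlt | hgt
  · have hlow := hpos_iff.2 hlt
    rw [if_neg hlt.not_gt, absLevel, max_eq_right (by linarith)]
    split_ifs
    · rfl
    · rw [quantile_lowerBranch a hlam ⟨hu, hlt⟩, hd.neg_pow]
  · have hlow := not_lt.1 (mt hpos_iff.1 hgt.not_gt)
    rw [if_pos hgt, absLevel, max_eq_left (by linarith)]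

end AbsoluteValue

section Coupling

variable {Ω : Type*} [MeasurableSpace Ω] {P : Measure Ω}

section Parity

variable {lam a : ℝ} (hlam : 0 < lam) {d : ℕ} {U V U₂ : Ω → ℝ} (hU : HasLaw U uniform01 P)
  (hU₂_even : Even d → ∀ ω, U₂ ω = mixU₂ (cdf (shiftedExp lam a)) lam a (U ω) (V ω))
  (hU₂_odd : Odd d → ∀ ω, U₂ ω = U ω)

include hlam hU hU₂_even hU₂_odd

theorem hasLaw_uniform01_of_eq_mixU₂_of_eq (hV : HasLaw V uniform01 P) (hUV : IndepFun U V P) :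
    HasLaw U₂ uniform01 P := by
  rcases Nat.even_or_odd d with hd | hd
  · rw [funext (hU₂_even hd)]
    exact hasLaw_mixU₂ hlam hU hV hUV
  · rwa [funext (hU₂_odd hd)]

theorem exists_monotoneOn_quantile_pow_ae_eq :
    ∃ k : ℝ → ℝ, MonotoneOn k (Ioo 0 1) ∧
      ∀ᵐ ω ∂P, quantile (cdf (shiftedExp lam a)) (U₂ ω) ^ d = k (U ω) := by
  rcases Nat.even_or_odd d with hd | hd
  · refine ⟨_, monotoneOn_quantile_absLevel_pow a hlam d, ?_⟩
    have hne : ∀ᵐ ω ∂P, U ω ≠ 1 - Real.exp (-2 * a * lam) :=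
      (hU.ae_iff (measurableSet_singleton _).compl.mem).2
        (ae_restrict_of_ae (Measure.ae_ne volume _))
    filter_upwards [ae_mem_Ioo_of_hasLaw_uniform01 hU, hne] with ω hω hω'
    rw [hU₂_even hd, quantile_mixU₂_pow_of_even a hlam hd hω.1 hω']
  · have hmono := monotoneOn_quantile_cdf (shiftedExp lam a)
    refine ⟨_, hd.strictMono_pow.monotone.comp_monotoneOn hmono, ?_⟩
    exact .of_forall fun ω => by rw [hU₂_odd hd, Function.comp_apply]

end Parity

variable [IsProbabilityMeasure P] {ν₁ ν₂ : Measure ℝ} {d : ℕ} {Y U : Ω → ℝ} {f k g : ℝ → ℝ}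
  {t : Set ℝ}

theorem maxMixedMoment_attained_of_monotoneOn (hUt : ∀ᵐ ω ∂P, U ω ∈ t)
    (hY₁ : HasLaw (fun ω => f (U ω)) ν₁ P) (hY₂ : HasLaw Y ν₂ P)
    (hYk : ∀ᵐ ω ∂P, Y ω ^ d = k (U ω))
    (hYg : IdentDistrib (fun ω => Y ω ^ d) (fun ω => g (U ω)) P P)
    (hint₁ : Integrable (fun ω => f (U ω)) P) (hint₂ : Integrable (fun ω => Y ω ^ d) P)
    (hf : MonotoneOn f t) (hk : MonotoneOn k t) (hg : MonotoneOn g t) :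
    (HasExpectation P (fun ω => f (U ω) * g (U ω)) ∧
      maxMixedMoment P ν₁ ν₂ d = expectation P (fun ω => f (U ω) * g (U ω))) ∧
    HasMixedMoment P ν₁ ν₂ d (fun ω => f (U ω)) Y (maxMixedMoment P ν₁ ν₂ d) := by
  have hs : ∀ᵐ ω ∂P, ω ∈ {ω | U ω ∈ t ∧ Y ω ^ d = k (U ω)} := hUt.and hYk
  have hfY : MonovaryOn (fun ω => f (U ω)) (fun ω => Y ω ^ d)
      {ω | U ω ∈ t ∧ Y ω ^ d = k (U ω)} := by
    rintro ω ⟨hω, hωk⟩ ω' ⟨hω', hω'k⟩ hlt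
    simp only [hωk, hω'k] at hlt
    exact hf.monovaryOn hk hω hω' hlt
  have hfg : MonovaryOn (fun ω => f (U ω)) (fun ω => g (U ω))
      {ω | U ω ∈ t ∧ Y ω ^ d = k (U ω)} :=
    fun _ hω _ hω' => hf.monovaryOn hg hω.1 hω'.1
  exact ⟨⟨hasExpectation_mul_of_monovaryOn hint₁ (hYg.integrable_snd hint₂) hs hfg,
    maxMixedMoment_eq_expectation_of_monovaryOn hY₁ hY₂ hYg hint₁ hint₂ hs hfY hfg⟩,
    hasMixedMoment_maxMixedMoment_of_monovaryOn hY₁ hY₂ hint₁ hint₂ hs hfY⟩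

theorem minMixedMoment_attained_of_antitoneOn (hUt : ∀ᵐ ω ∂P, U ω ∈ t)
    (hY₁ : HasLaw (fun ω => f (U ω)) ν₁ P) (hY₂ : HasLaw Y ν₂ P)
    (hYk : ∀ᵐ ω ∂P, Y ω ^ d = k (U ω))
    (hYg : IdentDistrib (fun ω => Y ω ^ d) (fun ω => g (U ω)) P P)
    (hint₁ : Integrable (fun ω => f (U ω)) P) (hint₂ : Integrable (fun ω => Y ω ^ d) P)
    (hf : AntitoneOn f t) (hk : MonotoneOn k t) (hg : MonotoneOn g t) :
    (HasExpectation P (fun ω => f (U ω) * g (U ω)) ∧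
      minMixedMoment P ν₁ ν₂ d = expectation P (fun ω => f (U ω) * g (U ω))) ∧
    HasMixedMoment P ν₁ ν₂ d (fun ω => f (U ω)) Y (minMixedMoment P ν₁ ν₂ d) := by
  have hs : ∀ᵐ ω ∂P, ω ∈ {ω | U ω ∈ t ∧ Y ω ^ d = k (U ω)} := hUt.and hYk
  have hfY : AntivaryOn (fun ω => f (U ω)) (fun ω => Y ω ^ d)
      {ω | U ω ∈ t ∧ Y ω ^ d = k (U ω)} := by
    rintro ω ⟨hω, hωk⟩ ω' ⟨hω', hω'k⟩ hlt
    simp only [hωk, hω'k] at hlt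
    exact hf.antivaryOn hk hω hω' hlt
  have hfg : AntivaryOn (fun ω => f (U ω)) (fun ω => g (U ω))
      {ω | U ω ∈ t ∧ Y ω ^ d = k (U ω)} :=
    fun _ hω _ hω' => hf.antivaryOn hg hω.1 hω'.1
  exact ⟨⟨hasExpectation_mul_of_antivaryOn hint₁ (hYg.integrable_snd hint₂) hs hfg,
    minMixedMoment_eq_expectation_of_antivaryOn hY₁ hY₂ hYg hint₁ hint₂ hs hfY hfg⟩,
    hasMixedMoment_minMixedMoment_of_antivaryOn hY₁ hY₂ hint₁ hint₂ hs hfY⟩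

end Coupling

theorem mainTheorem7 {Ω : Type*} [MeasurableSpace Ω] (P : Measure Ω) [IsProbabilityMeasure P]
    (lam a : ℝ) (hlam : 0 < lam) (d : ℕ) (hd : 0 < d)
    (X₁ X₂ U V : Ω → ℝ) (ν₁ ν₂ : Measure ℝ)
    (hX₁ : HasLaw X₁ ν₁ P) (hX₁int : Integrable X₁ P)
    (hX₂ : HasLaw X₂ ν₂ P) (hX₂exp : HasLaw (fun ω => X₂ ω + a) (expMeasure lam) P)
    (hU : HasLaw U uniform01 P) (hV : HasLaw V uniform01 P) (hUV : IndepFun U V P)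
    (F₁ F₂ G₂ : ℝ → ℝ) (hF₁ : F₁ = cdf ν₁) (hF₂ : F₂ = cdf ν₂)
    (hG₂ : G₂ = cdf (P.map (fun ω => X₂ ω ^ d)))
    (U₂ : Ω → ℝ)
    (hU₂_even : Even d → ∀ ω, U₂ ω = mixU₂ F₂ lam a (U ω) (V ω))
    (hU₂_odd : Odd d → ∀ ω, U₂ ω = U ω) :
    -- the value of the upper bound
    (HasExpectation P (fun ω => quantile F₁ (U ω) * quantile G₂ (U ω)) ∧
      maxMixedMoment P ν₁ ν₂ d =
        expectation P (fun ω => quantile F₁ (U ω) * quantile G₂ (U ω))) ∧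
    -- the upper bound is attained with `U₁ = U` and `U₂`
    HasMixedMoment P ν₁ ν₂ d (fun ω => quantile F₁ (U ω)) (fun ω => quantile F₂ (U₂ ω))
      (maxMixedMoment P ν₁ ν₂ d) ∧
    -- the value of the lower bound
    (HasExpectation P (fun ω => quantile F₁ (1 - U ω) * quantile G₂ (U ω)) ∧
      minMixedMoment P ν₁ ν₂ d =
        expectation P (fun ω => quantile F₁ (1 - U ω) * quantile G₂ (U ω))) ∧
    -- the lower bound is attained with `U₁ = 1 - U` and `U₂`
    HasMixedMoment P ν₁ ν₂ d (fun ω => quantile F₁ (1 - U ω)) (fun ω => quantile F₂ (U₂ ω))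
      (minMixedMoment P ν₁ ν₂ d) ∧
    -- `1 - U` and `U₂` are uniform, so that both pairs `(U₁, U₂)` follow a copula
    HasLaw (fun ω => 1 - U ω) uniform01 P ∧ HasLaw U₂ uniform01 P := by
  obtain rfl : ν₂ = shiftedExp lam a :=
    hX₂.map_eq.symm.trans (hasLaw_shiftedExp_of_hasLaw_add a hX₂exp).map_eq
  subst hF₁ hF₂ hG₂
  have hX₂d : HasLaw (fun ω => X₂ ω ^ d) (P.map fun ω => X₂ ω ^ d) P :=
    ⟨hX₂.aemeasurable.pow_const d, rfl⟩
  have := hX₁.isProbabilityMeasure_iff.1 ‹_›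
  have := hX₂.isProbabilityMeasure_iff.1 ‹_›
  have := hX₂d.isProbabilityMeasure_iff.1 ‹_›
  have hU₁ := hasLaw_one_sub_uniform01.fun_comp hU
  have hU₂ := hasLaw_uniform01_of_eq_mixU₂_of_eq hlam hU hU₂_even hU₂_odd hV hUV
  have hY₁_max := (hasLaw_quantile_cdf ν₁).fun_comp hU
  have hY₁_min := (hasLaw_quantile_cdf ν₁).fun_comp hU₁
  have hY₂ := (hasLaw_quantile_cdf (shiftedExp lam a)).fun_comp hU₂
  have hY₂d := (hY₂.identDistrib hX₂).pow.trans
    (hX₂d.identDistrib ((hasLaw_quantile_cdf _).fun_comp hU))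
  have hY₂int := integrable_pow_of_hasLaw_shiftedExp hlam a hY₂ d
  have hUmem := ae_mem_Ioo_of_hasLaw_uniform01 hU
  obtain ⟨k, hk, hY₂k⟩ := exists_monotoneOn_quantile_pow_ae_eq hlam hU hU₂_even hU₂_odd
  have hmax := maxMixedMoment_attained_of_monotoneOn hUmem hY₁_max hY₂ hY₂k hY₂d
    ((hX₁.identDistrib hY₁_max).integrable_snd hX₁int) hY₂int
    (monotoneOn_quantile_cdf ν₁) hk (monotoneOn_quantile_cdf _)
  have hmin := minMixedMoment_attained_of_antitoneOn hUmem hY₁_min hY₂ hY₂k hY₂d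
    ((hX₁.identDistrib hY₁_min).integrable_snd hX₁int) hY₂int
    (antitoneOn_quantile_cdf_one_sub ν₁) hk (monotoneOn_quantile_cdf _)
  exact ⟨hmax.1, hmax.2, hmin.1, hmin.2, hU₁, hU₂⟩
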